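/- Let $d\ge 0$ and let $\mathcal H\ne\{0\}$ be a complex Hilbert space which is continuously embedded in the space $\mathscr S'(\mathbf R^d)$ of tempered distributions. Suppose that $\mathcal H$ is norm preserved under translations and modulations, that is, for all $f\in\mathcal H$ and $x,\xi\in\mathbf R^d$ the distributions $f(\,\cdot\,-x)$ and $e^{i\langle\,\cdot\,,\xi\rangle}f$ belong to $\mathcal H$, and $$\|f(\,\cdot\,-x)\|_{\mathcal H}=\|f\|_{\mathcal H},\qquad \|e^{i\langle\,\cdot\,,\xi\rangle}f\|_{\mathcal H}=\|f\|_{\mathcal H}.$$ Then $\mathcal H=L^2(\mathbf R^d)$ as subspaces of $\mathscr S'(\mathbf R^d)$, and there is a constant $C>0$ such that $$\|f\|_{\mathcal H}=C\,\|f\|_{L^2(\mathbf R^d)}\qquad\text{for every } f\in\mathcal H=L^2(\mathbf R^d).$$ -/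

import Mathlib

open MeasureTheory SchwartzMap

noncomputable section

namespace TransMod

variable {d : ℕ}

/-- The imaginary exponential on the real line is smooth with bounded derivatives. -/
theorem hasTemperateGrowth_cexp_I :
    (fun t : ℝ => Complex.exp (Complex.I * (t : ℂ))).HasTemperateGrowth := by
  refine ⟨(contDiff_const.mul Complex.ofRealCLM.contDiff).cexp, fun n => ⟨0, 1, fun t => ?_⟩⟩
  have hder : ∀ n : ℕ, iteratedDeriv n (fun t : ℝ => Complex.exp (Complex.I * (t : ℂ))) =
      fun t : ℝ => Complex.I ^ n * Complex.exp (Complex.I * (t : ℂ)) := by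
    intro n
    induction n with
    | zero => simp
    | succ n ih =>
      rw [iteratedDeriv_succ, ih]
      funext t
      have h1 : HasDerivAt (fun t : ℝ => Complex.I * (t : ℂ)) Complex.I t := by
        simpa using (Complex.ofRealCLM.hasDerivAt (x := t)).const_mul Complex.I
      rw [(h1.cexp.const_mul (Complex.I ^ n)).deriv]
      ring
  rw [norm_iteratedFDeriv_eq_norm_iteratedDeriv, hder]
  simp [Complex.norm_exp]

/-- The character `y ↦ exp (i ⟨y, ξ⟩)` of `ℝ^d`. -/
def character (ξ : EuclideanSpace ℝ (Fin d)) (y : EuclideanSpace ℝ (Fin d)) : ℂ :=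
  Complex.exp (Complex.I * ((inner ℝ y ξ : ℝ) : ℂ))

theorem character_hasTemperateGrowth (ξ : EuclideanSpace ℝ (Fin d)) :
    (character ξ).HasTemperateGrowth :=
  hasTemperateGrowth_cexp_I.comp (Function.hasTemperateGrowth_inner_left ξ)

/-- The translation `f ↦ f(· - x)` on tempered distributions, defined by duality:
`⟨f(· - x), φ⟩ = ⟨f, φ(· + x)⟩`. -/
def translation (x : EuclideanSpace ℝ (Fin d)) :
    𝓢'(EuclideanSpace ℝ (Fin d), ℂ) →L[ℂ] 𝓢'(EuclideanSpace ℝ (Fin d), ℂ) :=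
  PointwiseConvergenceCLM.precomp ℂ (SchwartzMap.compSubConstCLM ℂ (-x))

/-- The modulation `f ↦ e^{i⟨·, ξ⟩} f` on tempered distributions, defined by duality:
`⟨e^{i⟨·, ξ⟩} f, φ⟩ = ⟨f, e^{i⟨·, ξ⟩} φ⟩`. -/
def modulation (ξ : EuclideanSpace ℝ (Fin d)) :
    𝓢'(EuclideanSpace ℝ (Fin d), ℂ) →L[ℂ] 𝓢'(EuclideanSpace ℝ (Fin d), ℂ) :=
  TemperedDistribution.smulLeftCLM ℂ (character ξ)

theorem translation_apply (x : EuclideanSpace ℝ (Fin d))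
    (f : 𝓢'(EuclideanSpace ℝ (Fin d), ℂ)) (φ ψ : 𝓢(EuclideanSpace ℝ (Fin d), ℂ))
    (h : ∀ y, ψ y = φ (y + x)) : translation x f φ = f ψ := by
  have : ψ = SchwartzMap.compSubConstCLM ℂ (-x) φ := by ext y; simp [h]
  rw [this]; rfl

theorem modulation_apply (ξ : EuclideanSpace ℝ (Fin d))
    (f : 𝓢'(EuclideanSpace ℝ (Fin d), ℂ)) (φ ψ : 𝓢(EuclideanSpace ℝ (Fin d), ℂ))
    (h : ∀ y, ψ y = Complex.exp (Complex.I * ((inner ℝ y ξ : ℝ) : ℂ)) * φ y) :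
    modulation ξ f φ = f ψ := by
  have : ψ = SchwartzMap.smulLeftCLM ℂ (character ξ) φ := by
    ext y
    simp [h, character_hasTemperateGrowth ξ, character]
  rw [this]; rfl

end TransMod

end

/-! By Riesz, each evaluation `f ↦ J f φ` is the inner product with a vector `riesz J φ`, and `B φ ψ
= ⟪riesz J φ, riesz J ψ⟫` is a Hermitian form on Schwartz space. It is continuous in `φ`, since `B φ
ψ = J (riesz J ψ) φ`, and invariant under translations and modulations.

Such a form is a multiple of the `L²` form. Superposing modulations by Fourier inversion gives `B (m
φ) ψ = B φ (conj m ψ)` (`IsInvariantForm.mul_left`). Superposing translates gives `∫ B (f · g(· -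
v)) ψ dv = (∫ g) B f ψ` (`IsInvariantForm.integral_mul_translate`). Together they yield
`IsInvariantForm.inner_mul_eq`. Both superpositions need a tempered distribution to pass through an
integral of Schwartz functions, which is `IntegrableFamily.integral_comp`.

Hence `φ ↦ riesz J (conj φ)` scales the `L²` norm by a constant and extends to all of `L²`. Its
image is closed, and dense because `J` is injective, so it is onto `H`; composed with `J` it is a
multiple of the inclusion of `L²`. -/

noncomputable section

namespace TransMod

open scoped BoundedContinuousFunction ContDiff Topology FourierTransform ComplexConjugate

universe u

/-! ### Integrals of families of Schwartz functions -/

section Integral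

variable {X : Type*} [MeasurableSpace X] [TopologicalSpace X] [OpensMeasurableSpace X]
  {D : Type u} [NormedAddCommGroup D] [NormedSpace ℝ D]

/-- A continuous family of Schwartz functions all of whose Schwartz seminorms are integrable. -/
structure IntegrableFamily {F : Type*} [NormedAddCommGroup F] [NormedSpace ℝ F]
    (μ : Measure X) (Φ : X → 𝓢(D, F)) : Prop where
  continuous : Continuous Φ
  integrable : ∀ k n : ℕ, Integrable (fun v => SchwartzMap.seminorm ℝ k n (Φ v)) μ

variable {μ : Measure X}

namespace IntegrableFamily

variable {F : Type*} [NormedAddCommGroup F] [NormedSpace ℝ F]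
  {G : Type*} [NormedAddCommGroup G] [NormedSpace ℝ G]

theorem continuous_seminorm (k n : ℕ) :
    Continuous (SchwartzMap.seminorm ℝ k n : 𝓢(D, F) → ℝ) :=
  (schwartz_withSeminorms ℝ D F).continuous_seminorm (k, n)

theorem of_le {Φ : X → 𝓢(D, F)} (hc : Continuous Φ)
    (hb : ∀ k n : ℕ, ∃ g : X → ℝ, Integrable g μ ∧ ∀ v, SchwartzMap.seminorm ℝ k n (Φ v) ≤ g v) :
    IntegrableFamily μ Φ := by
  refine ⟨hc, fun k n => ?_⟩
  obtain ⟨g, hg, hle⟩ := hb k n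
  refine hg.mono' ((continuous_seminorm k n).comp hc).aestronglyMeasurable ?_
  refine Filter.Eventually.of_forall fun v => ?_
  rw [Real.norm_of_nonneg (apply_nonneg _ _)]
  exact hle v

theorem map {Φ : X → 𝓢(D, F)} (h : IntegrableFamily μ Φ) (L : 𝓢(D, F) →L[ℝ] 𝓢(D, G)) :
    IntegrableFamily μ (fun v => L (Φ v)) := by
  refine of_le (L.continuous.comp h.continuous) fun k n => ?_
  obtain ⟨s, C, -, hC⟩ := Seminorm.bound_of_continuous (schwartz_withSeminorms ℝ D F)
    ((SchwartzMap.seminorm ℝ k n).comp L.toLinearMap)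
    (by exact (continuous_seminorm k n).comp L.continuous)
  refine ⟨fun v => C * ∑ i ∈ s, SchwartzMap.seminorm ℝ i.1 i.2 (Φ v),
    (integrable_finsetSum _ fun i _ => h.integrable i.1 i.2).const_mul _, fun v => ?_⟩
  refine (hC (Φ v)).trans ?_
  refine mul_le_mul_of_nonneg_left ?_ C.2
  refine (Seminorm.finset_sup_le_sum (schwartzSeminormFamily ℝ D F) s (Φ v)).trans ?_
  simp
  rfl

variable [SecondCountableTopology X]

theorem integrable_apply {Φ : X → 𝓢(D, F)} (h : IntegrableFamily μ Φ) (x : D) :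
    Integrable (fun v => Φ v x) μ := by
  refine (h.integrable 0 0).mono' (Continuous.aestronglyMeasurable ?_) ?_
  · exact ((BoundedContinuousFunction.evalCLM ℝ x).continuous.comp
      (toBoundedContinuousFunctionCLM ℝ D F).continuous).comp h.continuous
  · exact Filter.Eventually.of_forall fun v => norm_le_seminorm ℝ (Φ v) x

theorem hasFDerivAt_integral {Φ : X → 𝓢(D, F)} (h : IntegrableFamily μ Φ) (x : D) :
    HasFDerivAt (fun x => ∫ v, Φ v x ∂μ) (∫ v, fderivCLM ℝ D F (Φ v) x ∂μ) x := by
  have h' := h.map (fderivCLM ℝ D F)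
  refine hasFDerivAt_integral_of_dominated_of_fderiv_le (s := Set.univ)
    (F := fun x v => Φ v x) (F' := fun x v => fderivCLM ℝ D F (Φ v) x) Filter.univ_mem
    (Filter.Eventually.of_forall fun y => (h.integrable_apply y).aestronglyMeasurable)
    (h.integrable_apply x) (h'.integrable_apply x).aestronglyMeasurable
    (bound := fun v => SchwartzMap.seminorm ℝ 0 0 (fderivCLM ℝ D F (Φ v))) ?_
    (h'.integrable 0 0) ?_
  · exact Filter.Eventually.of_forall fun v y _ => norm_le_seminorm ℝ _ y
  · refine Filter.Eventually.of_forall fun v y _ => ?_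
    exact (Φ v).hasFDerivAt y

end IntegrableFamily

section Iterated

variable [SecondCountableTopology X]

/-- Induction by differentiating under the integral. The target `F` must vary, since the step passes
to `D →L[ℝ] F`; sharing the universe of `D` keeps that space in range. -/
theorem IntegrableFamily.iteratedFDeriv_integral (n : ℕ) :
    ∀ {F : Type u} [NormedAddCommGroup F] [NormedSpace ℝ F] {Φ : X → 𝓢(D, F)},
      IntegrableFamily μ Φ → ∀ x, iteratedFDeriv ℝ n (fun x => ∫ v, Φ v x ∂μ) x =
        ∫ v, iteratedFDeriv ℝ n (Φ v) x ∂μ := by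
  induction n with
  | zero =>
    intro F _ _ Φ h x
    simp only [iteratedFDeriv_zero_eq_comp, Function.comp_apply]
    exact ((continuousMultilinearCurryFin0 ℝ D F).symm.toContinuousLinearEquiv
      |>.integral_comp_comm _).symm
  | succ n ih =>
    intro F _ _ Φ h x
    have hd : fderiv ℝ (fun x => ∫ v, Φ v x ∂μ) = fun x => ∫ v, fderivCLM ℝ D F (Φ v) x ∂μ :=
      funext fun x => (h.hasFDerivAt_integral x).fderiv
    rw [iteratedFDeriv_succ_eq_comp_right, Function.comp_apply, hd,
      ih (h.map (fderivCLM ℝ D F))]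
    simp only [iteratedFDeriv_succ_eq_comp_right, Function.comp_apply]
    exact ((continuousMultilinearCurryRightEquiv' ℝ n D F).symm.toContinuousLinearEquiv
      |>.integral_comp_comm (μ := μ) fun v => iteratedFDeriv ℝ n (fderiv ℝ (Φ v)) x).symm

end Iterated

section Dual

variable {D : Type} [NormedAddCommGroup D] [NormedSpace ℝ D]

/-- The space of values of `iteratedFDeriv ℝ n f` for `f : D → ℂ`. -/
def DerivSpace (D : Type) [NormedAddCommGroup D] [NormedSpace ℝ D] (n : ℕ) : Type :=
  D [×n]→L[ℝ] ℂ

instance (n : ℕ) : NormedAddCommGroup (DerivSpace D n) :=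
  inferInstanceAs (NormedAddCommGroup (D [×n]→L[ℝ] ℂ))

instance (n : ℕ) : NormedSpace ℂ (DerivSpace D n) :=
  inferInstanceAs (NormedSpace ℂ (D [×n]→L[ℝ] ℂ))

instance (n : ℕ) : CompleteSpace (DerivSpace D n) :=
  inferInstanceAs (CompleteSpace (D [×n]→L[ℝ] ℂ))

/-- The weighted derivative `‖x‖ ^ k • D^n f x`. -/
def weightedDeriv (k n : ℕ) (f : D → ℂ) (x : D) : DerivSpace D n :=
  id ((‖x‖ ^ k : ℝ) • iteratedFDeriv ℝ n f x : D [×n]→L[ℝ] ℂ)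

theorem norm_weightedDeriv (k n : ℕ) (f : D → ℂ) (x : D) :
    ‖weightedDeriv k n f x‖ = ‖x‖ ^ k * ‖iteratedFDeriv ℝ n f x‖ := by
  change ‖((‖x‖ ^ k : ℝ) • iteratedFDeriv ℝ n f x : D [×n]→L[ℝ] ℂ)‖ = _
  rw [norm_smul, Real.norm_of_nonneg (by positivity)]

theorem continuous_weightedDeriv (k n : ℕ) (f : 𝓢(D, ℂ)) : Continuous (weightedDeriv k n f) := by
  have h : Continuous fun x : D =>
      ((‖x‖ ^ k : ℝ) • iteratedFDeriv ℝ n f x : D [×n]→L[ℝ] ℂ) :=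
    (by fun_prop : Continuous fun x : D => ‖x‖ ^ k).smul
      ((f.smooth ⊤).continuous_iteratedFDeriv (mod_cast le_top))
  exact h

theorem weightedDeriv_add (k n : ℕ) (f g : 𝓢(D, ℂ)) (x : D) :
    weightedDeriv k n (f + g : 𝓢(D, ℂ)) x = weightedDeriv k n f x + weightedDeriv k n g x := by
  have h : iteratedFDeriv ℝ n (f + g : 𝓢(D, ℂ)) x =
      iteratedFDeriv ℝ n f x + iteratedFDeriv ℝ n g x :=
    iteratedFDeriv_add_apply (f.smooth n).contDiffAt (g.smooth n).contDiffAt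
  have h' : ((‖x‖ ^ k : ℝ) • iteratedFDeriv ℝ n (f + g : 𝓢(D, ℂ)) x : D [×n]→L[ℝ] ℂ) =
      (‖x‖ ^ k : ℝ) • iteratedFDeriv ℝ n f x + (‖x‖ ^ k : ℝ) • iteratedFDeriv ℝ n g x := by
    rw [h, smul_add]
  exact h'

theorem weightedDeriv_smul (k n : ℕ) (c : ℂ) (f : 𝓢(D, ℂ)) (x : D) :
    weightedDeriv k n (c • f : 𝓢(D, ℂ)) x = c • weightedDeriv k n f x := by
  have h : iteratedFDeriv ℝ n (c • f : 𝓢(D, ℂ)) x = c • iteratedFDeriv ℝ n f x :=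
    iteratedFDeriv_const_smul_apply (f.smooth n).contDiffAt
  have h' : ((‖x‖ ^ k : ℝ) • iteratedFDeriv ℝ n (c • f : 𝓢(D, ℂ)) x : D [×n]→L[ℝ] ℂ) =
      c • (‖x‖ ^ k : ℝ) • iteratedFDeriv ℝ n f x := by
    rw [h, smul_comm]
  exact h'

theorem IntegrableFamily.weightedDeriv_integral [SecondCountableTopology X]
    {Φ : X → 𝓢(D, ℂ)} (h : IntegrableFamily μ Φ) (k n : ℕ) (x : D) :
    weightedDeriv k n (fun x => ∫ v, Φ v x ∂μ) x = ∫ v, weightedDeriv k n (Φ v) x ∂μ := by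
  have h' : ((‖x‖ ^ k : ℝ) • iteratedFDeriv ℝ n (fun x => ∫ v, Φ v x ∂μ) x : D [×n]→L[ℝ] ℂ) =
      ∫ v, (‖x‖ ^ k : ℝ) • iteratedFDeriv ℝ n (Φ v) x ∂μ := by
    rw [integral_smul, h.iteratedFDeriv_integral n x]
  exact h'

/-- The map `f ↦ ‖x‖ ^ k • D^n f` from Schwartz functions to bounded continuous functions. -/
def weightedDerivCLM (k n : ℕ) : 𝓢(D, ℂ) →L[ℂ] (D →ᵇ DerivSpace D n) :=
  mkCLMtoNormedSpace (σ := RingHom.id ℂ)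
    (fun f => BoundedContinuousFunction.ofNormedAddCommGroup (weightedDeriv k n f)
      (continuous_weightedDeriv k n f) (SchwartzMap.seminorm ℂ k n f)
      (fun x => (norm_weightedDeriv k n f x).trans_le (le_seminorm ℂ k n f x)))
    (fun f g => by ext1 x; exact weightedDeriv_add k n f g x)
    (fun c f => by ext1 x; exact weightedDeriv_smul k n c f x)
    ⟨{(k, n)}, 1, zero_le_one, fun f => by
      rw [Finset.sup_singleton, one_mul]
      exact BoundedContinuousFunction.norm_ofNormedAddCommGroup_le _ (apply_nonneg _ _) _⟩

theorem seminorm_le_norm_weightedDerivCLM (k n : ℕ) (f : 𝓢(D, ℂ)) :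
    SchwartzMap.seminorm ℂ k n f ≤ ‖weightedDerivCLM k n f‖ := by
  refine seminorm_le_bound ℂ k n f (norm_nonneg _) fun x => ?_
  rw [← norm_weightedDeriv]
  exact (weightedDerivCLM k n f).norm_coe_le_norm x

variable [SecondCountableTopology X]

theorem IntegrableFamily.integrable_weightedDerivCLM {Φ : X → 𝓢(D, ℂ)}
    (h : IntegrableFamily μ Φ) (k n : ℕ) :
    Integrable (fun v => weightedDerivCLM k n (Φ v)) μ := by
  refine (h.integrable k n).mono' ((weightedDerivCLM k n).continuous.comp
    h.continuous).aestronglyMeasurable (Filter.Eventually.of_forall fun v => ?_)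
  refine BoundedContinuousFunction.norm_le (apply_nonneg _ _) |>.2 fun x => ?_
  exact (norm_weightedDeriv k n (Φ v) x).trans_le (le_seminorm ℝ k n (Φ v) x)

/-- If `Ψ` is pointwise the integral of an integrable family of Schwartz functions, then every
tempered distribution commutes with that integral. -/
theorem IntegrableFamily.integral_comp {Φ : X → 𝓢(D, ℂ)} (h : IntegrableFamily μ Φ)
    {Ψ : 𝓢(D, ℂ)} (hΨ : ∀ x, Ψ x = ∫ v, Φ v x ∂μ) (u : 𝓢(D, ℂ) →L[ℂ] ℂ) :
    u Ψ = ∫ v, u (Φ v) ∂μ := by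
  -- Finitely many seminorms control `u`, so it factors through the map `Θ` into a finite product of
  -- Banach spaces, where Bochner integration is available.
  obtain ⟨s, C, -, hC⟩ := Seminorm.bound_of_continuous (schwartz_withSeminorms ℂ D ℂ)
    ((normSeminorm ℂ ℂ).comp u.toLinearMap) (by exact continuous_norm.comp u.continuous)
  let Θ : 𝓢(D, ℂ) →L[ℂ] (∀ i : s, D →ᵇ DerivSpace D (i : ℕ × ℕ).2) :=
    ContinuousLinearMap.pi fun i => weightedDerivCLM (i : ℕ × ℕ).1 (i : ℕ × ℕ).2
  have hbound : ∃ C : ℝ, ∀ f, ‖u.toLinearMap f‖ ≤ C * ‖Θ.toLinearMap f‖ := by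
    refine ⟨C, fun f => (hC f).trans ?_⟩
    refine mul_le_mul_of_nonneg_left ?_ C.2
    refine Seminorm.finset_sup_apply_le (norm_nonneg _) fun i hi => ?_
    exact (seminorm_le_norm_weightedDerivCLM i.1 i.2 f).trans
      (norm_le_pi_norm (Θ f) ⟨i, hi⟩)
  -- Hahn–Banach extends the induced functional from the range of `Θ` to the whole product.
  obtain ⟨w, hw, -⟩ := exists_extension_norm_eq (𝕜 := ℂ) (LinearMap.range Θ.toLinearMap)
    (u.toLinearMap.compLeftInverse Θ.toLinearMap)
  have huw : ∀ f, u f = w (Θ f) := fun f => by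
    have := hw ⟨Θ f, f, rfl⟩
    exact (LinearMap.compLeftInverse_apply_of_bdd _ _ hbound f _ rfl).symm.trans this.symm
  have hint : Integrable (fun v => Θ (Φ v)) μ :=
    Integrable.of_eval fun i => h.integrable_weightedDerivCLM _ _
  have hΘ : Θ Ψ = ∫ v, Θ (Φ v) ∂μ := by
    ext1 i
    ext1 x
    have e1 := ContinuousLinearMap.integral_comp_comm
      ((BoundedContinuousFunction.evalCLM ℝ x).comp (ContinuousLinearMap.proj (R := ℝ)
        (φ := fun i : s => D →ᵇ DerivSpace D (i : ℕ × ℕ).2) i)) hint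
    refine Eq.trans ?_ e1
    change weightedDeriv _ _ Ψ x = ∫ v, weightedDeriv _ _ (Φ v) x ∂μ
    rw [← h.weightedDeriv_integral]
    congr 1
    exact funext hΨ
  rw [huw, hΘ, ← ContinuousLinearMap.integral_comp_comm _ hint]
  exact integral_congr_ae (Filter.Eventually.of_forall fun v => (huw _).symm)

end Dual

end Integral

/-! ### Seminorm estimates for translates -/

section Translation

variable {E : Type} [NormedAddCommGroup E] [NormedSpace ℝ E]

theorem one_add_norm_pow_le {E : Type} [NormedAddCommGroup E] (k : ℕ) (x y : E) :
    (1 + ‖y‖) ^ k ≤ (1 + ‖x‖) ^ k * (1 + ‖x - y‖) ^ k := by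
  rw [← mul_pow]
  gcongr
  have h : ‖y‖ ≤ ‖x‖ + ‖x - y‖ := by
    simpa using norm_sub_le x (x - y)
  nlinarith [norm_nonneg x, norm_nonneg (x - y)]

theorem exists_one_add_norm_pow_mul_le (f : 𝓢(E, ℂ)) (k m : ℕ) :
    ∃ C : ℝ, 0 ≤ C ∧ ∀ n ≤ m, ∀ x, (1 + ‖x‖) ^ k * ‖iteratedFDeriv ℝ n f x‖ ≤ C :=
  ⟨_, by positivity, fun _ hn x =>
    one_add_le_sup_seminorm_apply (𝕜 := ℝ) (m := (k, m)) le_rfl hn f x⟩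

theorem iteratedFDeriv_compSubConstCLM (f : 𝓢(E, ℂ)) (n : ℕ) (a x : E) :
    iteratedFDeriv ℝ n (compSubConstCLM ℂ a f) x = iteratedFDeriv ℝ n f (x - a) :=
  iteratedFDeriv_comp_sub n a x

theorem exists_seminorm_compSubConstCLM_le (f : 𝓢(E, ℂ)) (k n : ℕ) :
    ∃ C : ℝ, 0 ≤ C ∧ ∀ a : E,
      SchwartzMap.seminorm ℝ k n (compSubConstCLM ℂ a f) ≤ C * (1 + ‖a‖) ^ k := by
  obtain ⟨C, hC, h⟩ := exists_one_add_norm_pow_mul_le f k n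
  refine ⟨C, hC, fun a => seminorm_le_bound ℝ k n _ (by positivity) fun x => ?_⟩
  rw [iteratedFDeriv_compSubConstCLM]
  have h1 : ‖x‖ ^ k ≤ (1 + ‖x - a‖) ^ k * (1 + ‖a‖) ^ k := by
    rw [← mul_pow]
    gcongr
    have : ‖x‖ ≤ ‖x - a‖ + ‖a‖ := by simpa using norm_add_le (x - a) a
    nlinarith [norm_nonneg a, norm_nonneg (x - a)]
  calc ‖x‖ ^ k * ‖iteratedFDeriv ℝ n f (x - a)‖
      ≤ (1 + ‖x - a‖) ^ k * (1 + ‖a‖) ^ k * ‖iteratedFDeriv ℝ n f (x - a)‖ := by gcongr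
    _ = (1 + ‖x - a‖) ^ k * ‖iteratedFDeriv ℝ n f (x - a)‖ * (1 + ‖a‖) ^ k := by ring
    _ ≤ C * (1 + ‖a‖) ^ k := by gcongr; exact h n le_rfl _

theorem exists_seminorm_compSubConstCLM_sub_le (f : 𝓢(E, ℂ)) (k n : ℕ) :
    ∃ C : ℝ, 0 ≤ C ∧ ∀ a : E, ‖a‖ ≤ 1 →
      SchwartzMap.seminorm ℝ k n (compSubConstCLM ℂ a f - f) ≤ C * ‖a‖ := by
  obtain ⟨C, hC, h⟩ := exists_one_add_norm_pow_mul_le f k (n + 1)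
  refine ⟨C, hC, fun a ha => seminorm_le_bound ℝ k n _ (by positivity) fun x => ?_⟩
  have hsub : iteratedFDeriv ℝ n (compSubConstCLM ℂ a f - f : 𝓢(E, ℂ)) x =
      iteratedFDeriv ℝ n f (x - a) - iteratedFDeriv ℝ n f x := by
    rw [← iteratedFDeriv_compSubConstCLM]
    exact iteratedFDeriv_sub_apply (SchwartzMap.smooth _ n).contDiffAt (f.smooth n).contDiffAt
  rw [hsub]
  -- The mean value inequality below uses the bound `C / ‖x‖ ^ k`, so a vanishing weight is treated
  -- apart.
  rcases (pow_nonneg (norm_nonneg x) k).eq_or_lt with hP | hP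
  · rw [← hP, zero_mul]
    positivity
  have hder : ∀ z ∈ Metric.closedBall x ‖a‖,
      DifferentiableAt ℝ (iteratedFDeriv ℝ n f) z := fun z _ =>
    (f.smooth ⊤).differentiable_iteratedFDeriv (mod_cast ENat.natCast_lt_top n) z
  have hbd : ∀ z ∈ Metric.closedBall x ‖a‖,
      ‖fderiv ℝ (iteratedFDeriv ℝ n f) z‖ ≤ C / ‖x‖ ^ k := by
    intro z hz
    rw [norm_fderiv_iteratedFDeriv, le_div_iff₀ hP, mul_comm]
    refine le_trans ?_ (h (n + 1) le_rfl z)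
    gcongr
    have h1 : ‖x‖ ≤ ‖z‖ + ‖x - z‖ := by simpa using norm_add_le z (x - z)
    have h2 : ‖x - z‖ ≤ ‖a‖ := by rw [← dist_eq_norm, dist_comm]; exact hz
    linarith
  have := (convex_closedBall x ‖a‖).norm_image_sub_le_of_norm_fderiv_le hder hbd
    (Metric.mem_closedBall_self (norm_nonneg a))
    (show x - a ∈ Metric.closedBall x ‖a‖ by simp)
  rw [sub_sub_cancel_left, norm_neg, div_mul_eq_mul_div, le_div_iff₀ hP] at this
  rwa [mul_comm]

theorem continuous_compSubConstCLM_left (f : 𝓢(E, ℂ)) :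
    Continuous fun a : E => compSubConstCLM ℂ a f := by
  have h0 : ∀ f : 𝓢(E, ℂ), Filter.Tendsto (fun a : E => compSubConstCLM ℂ a f) (𝓝 0) (𝓝 f) := by
    intro f
    refine ((schwartz_withSeminorms ℝ E ℂ).tendsto_nhds _ f).2 fun i ε hε => ?_
    obtain ⟨C, hC, h⟩ := exists_seminorm_compSubConstCLM_sub_le f i.1 i.2
    have h1 : ∀ᶠ a : E in 𝓝 0, ‖a‖ ≤ 1 := by
      filter_upwards [Metric.ball_mem_nhds (0 : E) one_pos] with a ha
      exact (mem_ball_zero_iff.1 ha).le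
    have h2 : ∀ᶠ a : E in 𝓝 0, C * ‖a‖ < ε := by
      have : Continuous fun a : E => C * ‖a‖ := by fun_prop
      exact (this.tendsto' 0 0 (by simp)).eventually_lt_const hε
    filter_upwards [h1, h2] with a ha1 ha2
    exact (h a ha1).trans_lt ha2
  refine continuous_iff_continuousAt.2 fun b => ?_
  have h1 : Filter.Tendsto (fun a : E => a - b) (𝓝 b) (𝓝 0) :=
    (continuous_id.sub continuous_const).tendsto' b 0 (sub_self b)
  refine ((h0 (compSubConstCLM ℂ b f)).comp h1).congr fun a => ?_
  simp

/-- The pointwise product of Schwartz functions. -/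
def mulCLM (f : 𝓢(E, ℂ)) : 𝓢(E, ℂ) →L[ℂ] 𝓢(E, ℂ) :=
  pairing (ContinuousLinearMap.mul ℂ ℂ) f

@[simp]
theorem mulCLM_apply (f g : 𝓢(E, ℂ)) (x : E) : mulCLM f g x = f x * g x := rfl

end Translation

/-! ### Integrable families of translates -/

section Families

variable {E : Type} [NormedAddCommGroup E] [NormedSpace ℝ E]
  [MeasurableSpace E] [BorelSpace E] (μ : Measure E) [μ.HasTemperateGrowth]

theorem integrableFamily_mulCLM_compSubConstCLM (f g : 𝓢(E, ℂ)) :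
    IntegrableFamily μ (fun v : E => mulCLM f (compSubConstCLM ℂ v g)) := by
  refine IntegrableFamily.of_le ((mulCLM f).continuous.comp
    (continuous_compSubConstCLM_left g)) fun k n => ?_
  set N := μ.integrablePower
  -- Decay in `v` comes from `1 + ‖v‖ ≤ (1 + ‖x‖)(1 + ‖x - v‖)`: `f` pays for `‖x‖ ^ k` and the
  -- first factor to the power `N`, `g` for the second.
  obtain ⟨A, hA, hf⟩ := exists_one_add_norm_pow_mul_le f (k + N) n
  obtain ⟨B, hB, hg⟩ := exists_one_add_norm_pow_mul_le g N n
  set K : ℝ := ∑ i ∈ Finset.range (n + 1), (n.choose i : ℝ) * (A * B)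
  have hK : 0 ≤ K := by positivity
  refine ⟨fun v => K * (1 + ‖v‖) ^ (-(N : ℝ)),
    (Measure.integrable_pow_neg_integrablePower μ).const_mul _,
    fun v => seminorm_le_bound ℝ k n _ (by positivity) fun x => ?_⟩
  dsimp only
  rw [Real.rpow_neg (by positivity), Real.rpow_natCast, ← div_eq_mul_inv,
    le_div_iff₀ (by positivity)]
  have hmul : ‖iteratedFDeriv ℝ n (mulCLM f (compSubConstCLM ℂ v g)) x‖ ≤
      ∑ i ∈ Finset.range (n + 1), (n.choose i : ℝ) * ‖iteratedFDeriv ℝ i f x‖ *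
        ‖iteratedFDeriv ℝ (n - i) g (x - v)‖ := by
    have := norm_iteratedFDeriv_mul_le (𝕜 := ℝ) (N := ∞) (f.smooth ⊤)
      ((compSubConstCLM ℂ v g).smooth ⊤) x (n := n) (mod_cast le_top)
    simp only [iteratedFDeriv_compSubConstCLM] at this
    exact this
  calc ‖x‖ ^ k * ‖iteratedFDeriv ℝ n (mulCLM f (compSubConstCLM ℂ v g)) x‖ * (1 + ‖v‖) ^ N
      ≤ (1 + ‖x‖) ^ k * (∑ i ∈ Finset.range (n + 1), (n.choose i : ℝ) *
          ‖iteratedFDeriv ℝ i f x‖ * ‖iteratedFDeriv ℝ (n - i) g (x - v)‖) *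
          ((1 + ‖x‖) ^ N * (1 + ‖x - v‖) ^ N) := by
        gcongr
        · linarith
        · exact one_add_norm_pow_le N x v
    _ = ∑ i ∈ Finset.range (n + 1), (n.choose i : ℝ) *
          (((1 + ‖x‖) ^ (k + N) * ‖iteratedFDeriv ℝ i f x‖) *
          ((1 + ‖x - v‖) ^ N * ‖iteratedFDeriv ℝ (n - i) g (x - v)‖)) := by
        rw [Finset.mul_sum, Finset.sum_mul]
        refine Finset.sum_congr rfl fun i _ => ?_
        ring
    _ ≤ K := by
        refine Finset.sum_le_sum fun i hi => ?_
        have hi' : i ≤ n := Nat.lt_succ_iff.1 (Finset.mem_range.1 hi)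
        gcongr
        · exact hf i hi' x
        · exact hg (n - i) (Nat.sub_le n i) _

variable [SecondCountableTopology E]

/-- Seminorms of translates grow only polynomially, which the Schwartz weight `a` absorbs. -/
theorem integrableFamily_smul_compSubConstCLM (a f : 𝓢(E, ℂ)) (c : ℝ) :
    IntegrableFamily μ (fun v : E => a v • compSubConstCLM ℂ (c • v) f) := by
  refine IntegrableFamily.of_le (a.continuous.smul
    ((continuous_compSubConstCLM_left f).comp (continuous_const_smul c))) fun k n => ?_
  obtain ⟨C, hC, h⟩ := exists_seminorm_compSubConstCLM_le f k n
  refine ⟨fun v => C * (2 ^ (k - 1) * (‖a v‖ + |c| ^ k * (‖v‖ ^ k * ‖a v‖))),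
    (((a.integrable.norm).add ((a.integrable_pow_mul μ k).const_mul _)).const_mul _).const_mul _,
    fun v => ?_⟩
  have h1 : SchwartzMap.seminorm ℝ k n (a v • compSubConstCLM ℂ (c • v) f) =
      ‖a v‖ * SchwartzMap.seminorm ℝ k n (compSubConstCLM ℂ (c • v) f) :=
    map_smul_eq_mul (SchwartzMap.seminorm ℂ k n) (a v) _
  rw [h1]
  calc ‖a v‖ * SchwartzMap.seminorm ℝ k n (compSubConstCLM ℂ (c • v) f)
      ≤ ‖a v‖ * (C * (1 + ‖c • v‖) ^ k) := by gcongr; exact h _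
    _ ≤ ‖a v‖ * (C * (2 ^ (k - 1) * (1 ^ k + ‖c • v‖ ^ k))) := by
        gcongr
        exact add_pow_le zero_le_one (norm_nonneg _) k
    _ = _ := by rw [norm_smul, mul_pow, Real.norm_eq_abs]; ring

end Families

/-! ### Modulations as Fourier conjugates of translations -/

section Modulation

variable {d : ℕ}

/-- Multiplication of Schwartz functions by a character. -/
def modulate (ξ : EuclideanSpace ℝ (Fin d)) :
    𝓢(EuclideanSpace ℝ (Fin d), ℂ) →L[ℂ] 𝓢(EuclideanSpace ℝ (Fin d), ℂ) :=
  SchwartzMap.smulLeftCLM ℂ (character ξ)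

@[simp]
theorem modulate_apply (ξ x : EuclideanSpace ℝ (Fin d)) (f : 𝓢(EuclideanSpace ℝ (Fin d), ℂ)) :
    modulate ξ f x = character ξ x * f x := by
  simp [modulate, character_hasTemperateGrowth ξ]

theorem modulate_eq_fourierInv (ξ : EuclideanSpace ℝ (Fin d))
    (f : 𝓢(EuclideanSpace ℝ (Fin d), ℂ)) :
    modulate ξ f = 𝓕⁻ (compSubConstCLM ℂ ((2 * Real.pi)⁻¹ • ξ) (𝓕 f)) := by
  have h : 𝓕 (modulate ξ f) = compSubConstCLM ℂ ((2 * Real.pi)⁻¹ • ξ) (𝓕 f) := by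
    ext w
    rw [compSubConstCLM_apply, fourier_coe, fourier_coe, Real.fourier_eq', Real.fourier_eq']
    refine integral_congr_ae (Filter.Eventually.of_forall fun v => ?_)
    simp only [modulate_apply, character, smul_eq_mul]
    rw [← mul_assoc, ← Complex.exp_add, inner_sub_right, inner_smul_right]
    congr 2
    push_cast
    field_simp
    ring
  rw [← h, FourierTransform.fourierInv_fourier_eq]

theorem integrableFamily_smul_modulate (a f : 𝓢(EuclideanSpace ℝ (Fin d), ℂ)) (c : ℝ) :
    IntegrableFamily volume (fun v => a v • modulate (c • v) f) := by
  have h := (integrableFamily_smul_compSubConstCLM volume a (𝓕 f) ((2 * Real.pi)⁻¹ * c)).map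
    (FourierTransform.fourierInvCLM ℝ 𝓢(EuclideanSpace ℝ (Fin d), ℂ))
  have he : (fun v => a v • modulate (c • v) f) = fun v =>
      FourierTransform.fourierInvCLM ℝ 𝓢(EuclideanSpace ℝ (Fin d), ℂ)
        (a v • compSubConstCLM ℂ (((2 * Real.pi)⁻¹ * c) • v) (𝓕 f)) := by
    funext v
    rw [modulate_eq_fourierInv, smul_smul]
    exact (FourierTransform.fourierInv_smul (a v) _).symm
  rw [he]
  exact h

end Modulation

/-! ### Uniqueness of the invariant form -/

section InvariantForm

variable {d : ℕ}

/-- The complex conjugate of a Schwartz function. -/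
def conjSchwartz (f : 𝓢(EuclideanSpace ℝ (Fin d), ℂ)) : 𝓢(EuclideanSpace ℝ (Fin d), ℂ) :=
  postcompCLM (Complex.conjCLE : ℂ →L[ℝ] ℂ) f

@[simp]
theorem conjSchwartz_apply (f : 𝓢(EuclideanSpace ℝ (Fin d), ℂ)) (x : EuclideanSpace ℝ (Fin d)) :
    conjSchwartz f x = conj (f x) := rfl

/-- A Hermitian form on Schwartz space, continuous in its first argument, which is invariant under
simultaneous translations and modulations of its arguments. -/
structure IsInvariantForm
    (B : 𝓢(EuclideanSpace ℝ (Fin d), ℂ) → 𝓢(EuclideanSpace ℝ (Fin d), ℂ) → ℂ) : Prop where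
  exists_clm : ∀ ψ, ∃ u : 𝓢(EuclideanSpace ℝ (Fin d), ℂ) →L[ℂ] ℂ, ∀ φ, u φ = B φ ψ
  conj_symm : ∀ φ ψ, conj (B φ ψ) = B ψ φ
  translate : ∀ (x : EuclideanSpace ℝ (Fin d)) (φ ψ : 𝓢(EuclideanSpace ℝ (Fin d), ℂ)),
    B (compSubConstCLM ℂ x φ) (compSubConstCLM ℂ x ψ) = B φ ψ
  modulate : ∀ (ξ : EuclideanSpace ℝ (Fin d)) (φ ψ : 𝓢(EuclideanSpace ℝ (Fin d), ℂ)),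
    B (modulate ξ φ) (modulate ξ ψ) = B φ ψ

theorem modulate_modulate_neg (ξ : EuclideanSpace ℝ (Fin d))
    (f : 𝓢(EuclideanSpace ℝ (Fin d), ℂ)) : modulate ξ (modulate (-ξ) f) = f := by
  ext x
  rw [modulate_apply, modulate_apply, ← mul_assoc, character, character, ← Complex.exp_add]
  simp [inner_neg_right]

theorem integral_smul_modulate_eq_fourier_mul (a f : 𝓢(EuclideanSpace ℝ (Fin d), ℂ))
    (x : EuclideanSpace ℝ (Fin d)) :
    mulCLM (𝓕 a) f x = ∫ v, (a v • TransMod.modulate ((-(2 * Real.pi)) • v) f) x := by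
  rw [mulCLM_apply, fourier_coe, Real.fourier_eq', ← integral_mul_const]
  refine integral_congr_ae (Filter.Eventually.of_forall fun v => ?_)
  have : (a v • TransMod.modulate ((-(2 * Real.pi)) • v) f) x =
      a v * (character ((-(2 * Real.pi)) • v) x * f x) := by
    rw [← modulate_apply]; rfl
  refine Eq.trans ?_ this.symm
  simp only [character, smul_eq_mul]
  rw [inner_smul_right, real_inner_comm x v, mul_left_comm, ← mul_assoc]
  congr 3
  push_cast
  ring

theorem integral_smul_modulate_eq_conj_fourier_mul (a f : 𝓢(EuclideanSpace ℝ (Fin d), ℂ))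
    (x : EuclideanSpace ℝ (Fin d)) :
    mulCLM (conjSchwartz (𝓕 a)) f x =
      ∫ v, (conjSchwartz a v • TransMod.modulate ((2 * Real.pi) • v) f) x := by
  rw [mulCLM_apply, conjSchwartz_apply, fourier_coe, Real.fourier_eq', ← integral_conj,
    ← integral_mul_const]
  refine integral_congr_ae (Filter.Eventually.of_forall fun v => ?_)
  have : (conjSchwartz a v • TransMod.modulate ((2 * Real.pi) • v) f) x =
      conj (a v) * (character ((2 * Real.pi) • v) x * f x) := by
    rw [← modulate_apply]; rfl
  refine Eq.trans ?_ this.symm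
  simp only [character, smul_eq_mul]
  rw [inner_smul_right, real_inner_comm x v, mul_left_comm, ← mul_assoc, map_mul, ← Complex.exp_conj]
  congr 3
  simp only [map_mul, Complex.conj_ofReal, Complex.conj_I]
  push_cast
  ring

theorem integral_mulCLM_compSubConstCLM (f g : 𝓢(EuclideanSpace ℝ (Fin d), ℂ))
    (x : EuclideanSpace ℝ (Fin d)) :
    ((∫ y, g y) • f : 𝓢(EuclideanSpace ℝ (Fin d), ℂ)) x =
      ∫ v, mulCLM f (compSubConstCLM ℂ v g) x := by
  simp only [mulCLM_apply, compSubConstCLM_apply]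
  rw [integral_const_mul, integral_sub_left_eq_self (fun y => g y) volume x, mul_comm]
  rfl

namespace IsInvariantForm

variable {B : 𝓢(EuclideanSpace ℝ (Fin d), ℂ) → 𝓢(EuclideanSpace ℝ (Fin d), ℂ) → ℂ}

theorem modulate_left (hB : IsInvariantForm B) (ξ : EuclideanSpace ℝ (Fin d))
    (φ ψ : 𝓢(EuclideanSpace ℝ (Fin d), ℂ)) :
    B (TransMod.modulate ξ φ) ψ = B φ (TransMod.modulate (-ξ) ψ) := by
  rw [← hB.modulate ξ φ, modulate_modulate_neg]

theorem translate_left (hB : IsInvariantForm B) (x : EuclideanSpace ℝ (Fin d))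
    (φ ψ : 𝓢(EuclideanSpace ℝ (Fin d), ℂ)) :
    B (compSubConstCLM ℂ x φ) ψ = B φ (compSubConstCLM ℂ (-x) ψ) := by
  rw [← hB.translate x φ]
  simp

theorem smul_left (hB : IsInvariantForm B) (c : ℂ) (φ ψ : 𝓢(EuclideanSpace ℝ (Fin d), ℂ)) :
    B (c • φ) ψ = c * B φ ψ := by
  obtain ⟨u, hu⟩ := hB.exists_clm ψ
  rw [← hu, ← hu, map_smul, smul_eq_mul]

theorem smul_right (hB : IsInvariantForm B) (c : ℂ) (φ ψ : 𝓢(EuclideanSpace ℝ (Fin d), ℂ)) :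
    B φ (c • ψ) = conj c * B φ ψ := by
  rw [← hB.conj_symm, hB.smul_left, map_mul, hB.conj_symm]

theorem eq_integral (hB : IsInvariantForm B) {Φ : EuclideanSpace ℝ (Fin d) → _}
    (h : IntegrableFamily volume Φ) {Ψ : 𝓢(EuclideanSpace ℝ (Fin d), ℂ)}
    (hΨ : ∀ x, Ψ x = ∫ v, Φ v x) (ψ : 𝓢(EuclideanSpace ℝ (Fin d), ℂ)) :
    B Ψ ψ = ∫ v, B (Φ v) ψ := by
  obtain ⟨u, hu⟩ := hB.exists_clm ψ
  simp only [← hu]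
  exact h.integral_comp hΨ u

/-- With `m = 𝓕 a`, multiplication by `m` is a superposition of modulations weighted by `a`, and
invariance moves each of them to the other argument. -/
theorem mul_left (hB : IsInvariantForm B) (m φ ψ : 𝓢(EuclideanSpace ℝ (Fin d), ℂ)) :
    B (mulCLM m φ) ψ = B φ (mulCLM (conjSchwartz m) ψ) := by
  obtain ⟨a, rfl⟩ : ∃ a : 𝓢(EuclideanSpace ℝ (Fin d), ℂ), 𝓕 a = m :=
    ⟨𝓕⁻ m, FourierTransform.fourier_fourierInv_eq m⟩
  rw [hB.eq_integral (integrableFamily_smul_modulate a φ _)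
      (integral_smul_modulate_eq_fourier_mul a φ), ← hB.conj_symm _ φ,
    hB.eq_integral (integrableFamily_smul_modulate (conjSchwartz a) ψ _)
      (integral_smul_modulate_eq_conj_fourier_mul a ψ), ← integral_conj]
  refine integral_congr_ae (Filter.Eventually.of_forall fun v => ?_)
  dsimp only
  rw [hB.conj_symm, hB.smul_left, hB.smul_right, conjSchwartz_apply, Complex.conj_conj,
    hB.modulate_left, neg_smul, neg_neg]

/-- The translates of `g` integrate pointwise to the constant `∫ g`. -/
theorem integral_mul_translate (hB : IsInvariantForm B)
    (f g ψ : 𝓢(EuclideanSpace ℝ (Fin d), ℂ)) :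
    ∫ v, B (mulCLM f (compSubConstCLM ℂ v g)) ψ = (∫ y, g y) * B f ψ := by
  rw [← hB.smul_left]
  exact (hB.eq_integral (integrableFamily_mulCLM_compSubConstCLM volume f g)
    (integral_mulCLM_compSubConstCLM f g) ψ).symm

/-- An invariant form is determined up to a constant: it is a multiple of the `L²` form. -/
theorem integral_mul_eq (hB : IsInvariantForm B) (f g φ ψ : 𝓢(EuclideanSpace ℝ (Fin d), ℂ)) :
    (∫ y, mulCLM g f y) * B φ ψ =
      conj (∫ y, mulCLM (conjSchwartz φ) ψ y) * B f (conjSchwartz g) := by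
  -- Both sides become integrals over translations. Moving `φ`, then the translation, then `g`
  -- across `B` matches the integrands up to `v ↦ -v`.
  rw [← hB.integral_mul_translate, ← hB.conj_symm _ f, ← map_mul, ← hB.integral_mul_translate,
    ← integral_conj, ← integral_neg_eq_self]
  refine integral_congr_ae (Filter.Eventually.of_forall fun v => ?_)
  dsimp only
  rw [hB.mul_left, hB.translate_left, hB.mul_left, hB.conj_symm, neg_neg]

theorem inner_mul_eq (hB : IsInvariantForm B) (f φ ψ : 𝓢(EuclideanSpace ℝ (Fin d), ℂ)) :
    inner ℂ (f.toLp 2) (f.toLp 2) * B φ ψ = inner ℂ (ψ.toLp 2) (φ.toLp 2) * B f f := by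
  have h := hB.integral_mul_eq f (conjSchwartz f) φ ψ
  have h1 : conjSchwartz (conjSchwartz f) = f := by ext x; simp
  have h2 : ∀ f g : 𝓢(EuclideanSpace ℝ (Fin d), ℂ),
      inner ℂ (f.toLp 2) (g.toLp 2) = ∫ y, mulCLM (conjSchwartz f) g y := by
    intro f g
    refine (inner_toL2_toL2_eq f g volume).trans ?_
    refine integral_congr_ae (Filter.Eventually.of_forall fun v => ?_)
    simp [mul_comm]
  rw [h1, ← h2, ← h2, inner_conj_symm] at h
  exact h

end IsInvariantForm

end InvariantForm

/-! ### Riesz representatives of test functions -/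

section Riesz

variable {d : ℕ} {H : Type*} [NormedAddCommGroup H] [InnerProductSpace ℂ H] [CompleteSpace H]
  (J : H →L[ℂ] 𝓢'(EuclideanSpace ℝ (Fin d), ℂ))

/-- The Riesz representative of the functional `f ↦ J f φ`. -/
def riesz (φ : 𝓢(EuclideanSpace ℝ (Fin d), ℂ)) : H :=
  (InnerProductSpace.toDual ℂ H).symm
    ((PointwiseConvergenceCLM.evalCLM (RingHom.id ℂ) ℂ φ).comp J)

@[simp]
theorem inner_riesz_left (φ : 𝓢(EuclideanSpace ℝ (Fin d), ℂ)) (f : H) :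
    inner ℂ (riesz J φ) f = J f φ := by
  rw [riesz, InnerProductSpace.toDual_symm_apply]
  rfl

variable {J}

/-- Injectivity of `J` makes the lift `V` of the transpose of `R'` linear, hence an isometry, with
right inverse the lift `U` of the transpose of `R`. Thus `V` is unitary and sends `riesz J χ` to
`riesz J (R χ)`. -/
theorem inner_riesz_map (hJ : Function.Injective J)
    {R R' : 𝓢(EuclideanSpace ℝ (Fin d), ℂ) →L[ℂ] 𝓢(EuclideanSpace ℝ (Fin d), ℂ)}
    (hRR' : ∀ φ, R (R' φ) = φ)
    (hR : ∀ f : H, ∃ g : H, (∀ φ, J g φ = J f (R φ)) ∧ ‖g‖ = ‖f‖)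
    (hR' : ∀ f : H, ∃ g : H, (∀ φ, J g φ = J f (R' φ)) ∧ ‖g‖ = ‖f‖)
    (φ ψ : 𝓢(EuclideanSpace ℝ (Fin d), ℂ)) :
    inner ℂ (riesz J (R φ)) (riesz J (R ψ)) = inner ℂ (riesz J φ) (riesz J ψ) := by
  choose U hU _ using hR
  choose V hV hVn using hR'
  let V' : H →ₗᵢ[ℂ] H :=
    { toFun := V
      map_add' := fun f g => hJ (by ext χ; simp [hV])
      map_smul' := fun c f => hJ (by ext χ; simp [hV])
      norm_map' := hVn }
  have hVU : ∀ f, V' (U f) = f := fun f => hJ (by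
    ext χ
    change J (V (U f)) χ = J f χ
    rw [hV, hU, hRR'])
  have key : ∀ χ, riesz J (R χ) = V' (riesz J χ) := fun χ => by
    refine ext_inner_right ℂ fun f => ?_
    conv_rhs => rw [← hVU f]
    rw [V'.inner_map_map, inner_riesz_left, inner_riesz_left, hU]
  rw [key, key, V'.inner_map_map]

theorem isInvariantForm_inner_riesz (hJ : Function.Injective J)
    (htrans : ∀ (x : EuclideanSpace ℝ (Fin d)) (f : H),
      ∃ g : H, J g = TransMod.translation x (J f) ∧ ‖g‖ = ‖f‖)
    (hmod : ∀ (ξ : EuclideanSpace ℝ (Fin d)) (f : H),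
      ∃ g : H, J g = TransMod.modulation ξ (J f) ∧ ‖g‖ = ‖f‖) :
    IsInvariantForm fun φ ψ => inner ℂ (riesz J φ) (riesz J ψ) where
  exists_clm ψ := ⟨(show 𝓢(EuclideanSpace ℝ (Fin d), ℂ) →L[ℂ] ℂ from J (riesz J ψ)),
    fun φ => (inner_riesz_left J φ _).symm⟩
  conj_symm φ ψ := inner_conj_symm _ _
  translate x φ ψ := by
    have h : ∀ (y : EuclideanSpace ℝ (Fin d)) (f : H), ∃ g : H,
        (∀ χ, J g χ = J f (compSubConstCLM ℂ y χ)) ∧ ‖g‖ = ‖f‖ := fun y f => by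
      obtain ⟨g, hg, hn⟩ := htrans (-y) f
      refine ⟨g, fun χ => ?_, hn⟩
      rw [hg]
      exact translation_apply _ _ _ _ fun z => by simp [sub_eq_add_neg]
    exact inner_riesz_map hJ (R := compSubConstCLM ℂ x) (R' := compSubConstCLM ℂ (-x))
      (fun χ => by simp) (h x) (h (-x)) φ ψ
  modulate ξ φ ψ := by
    have h : ∀ (η : EuclideanSpace ℝ (Fin d)) (f : H), ∃ g : H,
        (∀ χ, J g χ = J f (TransMod.modulate η χ)) ∧ ‖g‖ = ‖f‖ := fun η f => by
      obtain ⟨g, hg, hn⟩ := hmod η f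
      refine ⟨g, fun χ => ?_, hn⟩
      rw [hg]
      exact modulation_apply _ _ _ _ fun z => modulate_apply η z χ
    exact inner_riesz_map hJ (modulate_modulate_neg ξ) (h ξ) (h (-ξ)) φ ψ

theorem exists_riesz_ne_zero [Nontrivial H] (hJ : Function.Injective J) :
    ∃ φ, riesz J φ ≠ 0 := by
  obtain ⟨f, hf⟩ := exists_ne (0 : H)
  by_contra! h
  refine hf (hJ ?_)
  ext φ
  rw [← inner_riesz_left, h φ]
  simp

variable (J) in
/-- The linear map `φ ↦ riesz J (conj φ)`. -/
def rieszConj : 𝓢(EuclideanSpace ℝ (Fin d), ℂ) →ₗ[ℂ] H where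
  toFun φ := riesz J (conjSchwartz φ)
  map_add' φ ψ := by
    have h : conjSchwartz (φ + ψ) = conjSchwartz φ + conjSchwartz ψ := by ext x; simp
    refine ext_inner_right ℂ fun f => ?_
    rw [inner_add_left, inner_riesz_left, inner_riesz_left, inner_riesz_left, h, map_add]
  map_smul' c φ := by
    have h : conjSchwartz (c • φ) = conj c • conjSchwartz φ := by ext x; simp
    refine ext_inner_right ℂ fun f => ?_
    rw [RingHom.id_apply, inner_smul_left, inner_riesz_left, inner_riesz_left, h, map_smul,
      smul_eq_mul]

theorem rieszConj_apply (φ : 𝓢(EuclideanSpace ℝ (Fin d), ℂ)) :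
    rieszConj J φ = riesz J (conjSchwartz φ) := rfl

theorem exists_inner_riesz_eq [Nontrivial H] (hJ : Function.Injective J)
    (hB : IsInvariantForm fun φ ψ => inner ℂ (riesz J φ) (riesz J ψ)) :
    ∃ C : ℝ, 0 < C ∧ ∀ φ ψ, inner ℂ (riesz J φ) (riesz J ψ) =
      (C ^ 2 : ℂ) * inner ℂ (ψ.toLp 2) (φ.toLp 2) := by
  obtain ⟨χ, hχ⟩ := exists_riesz_ne_zero hJ
  have hχ' : χ.toLp 2 ≠ 0 := fun h => hχ (by
    have h0 : χ = 0 := injective_toLp 2 volume (by exact h)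
    refine ext_inner_right ℂ fun f => ?_
    simp [h0])
  have h1 : (‖χ.toLp 2‖ : ℂ) ≠ 0 := by simpa using hχ'
  -- The constant is read off from one test function with nonzero representative.
  refine ⟨‖riesz J χ‖ / ‖χ.toLp 2‖, div_pos (norm_pos_iff.2 hχ) (norm_pos_iff.2 hχ'),
    fun φ ψ => ?_⟩
  have h := hB.inner_mul_eq χ φ ψ
  rw [inner_self_eq_norm_sq_to_K, inner_self_eq_norm_sq_to_K] at h
  push_cast
  rw [div_pow, div_mul_eq_mul_div, eq_div_iff (pow_ne_zero 2 h1), mul_comm]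
  exact h.trans (mul_comm _ _)

end Riesz

end TransMod

end

/-! ### Identification of `H` with `L²` -/

theorem theorem1p2 (d : ℕ)
    {H : Type*} [NormedAddCommGroup H] [InnerProductSpace ℂ H] [CompleteSpace H] [Nontrivial H]
    -- the continuous embedding of the Hilbert space `H` into the tempered distributions
    (J : H →L[ℂ] 𝓢'(EuclideanSpace ℝ (Fin d), ℂ)) (hJ : Function.Injective J)
    -- `H` is invariant under translations and modulations, with preservation of the norm
    (htrans : ∀ (x : EuclideanSpace ℝ (Fin d)) (f : H),
      ∃ g : H, J g = TransMod.translation x (J f) ∧ ‖g‖ = ‖f‖)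
    (hmod : ∀ (ξ : EuclideanSpace ℝ (Fin d)) (f : H),
      ∃ g : H, J g = TransMod.modulation ξ (J f) ∧ ‖g‖ = ‖f‖) :
    -- `H = L²(ℝ^d)` as subspaces of the tempered distributions
    Set.range J = Set.range (Lp.toTemperedDistributionCLM ℂ
      (volume : Measure (EuclideanSpace ℝ (Fin d))) 2) ∧
    -- and the two norms are proportional
    ∃ C : ℝ, 0 < C ∧ ∀ (f : H) (g : Lp ℂ 2 (volume : Measure (EuclideanSpace ℝ (Fin d)))),
      J f = Lp.toTemperedDistributionCLM ℂ volume 2 g → ‖f‖ = C * ‖g‖ := by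
  obtain ⟨C, hC, hBC⟩ := TransMod.exists_inner_riesz_eq hJ
    (TransMod.isInvariantForm_inner_riesz hJ htrans hmod)
  have hCc : (C : ℂ) ≠ 0 := by exact_mod_cast hC.ne'
  let e : 𝓢(EuclideanSpace ℝ (Fin d), ℂ) →ₗ[ℂ]
      Lp ℂ 2 (volume : Measure (EuclideanSpace ℝ (Fin d))) :=
    (SchwartzMap.toLpCLM ℂ ℂ 2 volume).toLinearMap
  have he : DenseRange e := SchwartzMap.denseRange_toLpCLM (by simp)
  have hnorm : ∀ φ, ‖TransMod.rieszConj J φ‖ = C * ‖e φ‖ := by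
    intro φ
    have h1 : inner ℂ ((TransMod.conjSchwartz φ).toLp 2 volume)
        ((TransMod.conjSchwartz φ).toLp 2 volume) =
        inner ℂ (φ.toLp 2 volume) (φ.toLp 2 volume) := by
      refine (inner_toL2_toL2_eq _ _ volume).trans
        (Eq.trans ?_ (inner_toL2_toL2_eq _ _ volume).symm)
      refine integral_congr_ae (Filter.Eventually.of_forall fun x => ?_)
      simp
    have h2 := hBC (TransMod.conjSchwartz φ) (TransMod.conjSchwartz φ)
    rw [h1, inner_self_eq_norm_sq_to_K, inner_self_eq_norm_sq_to_K] at h2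
    have h3 : ‖TransMod.rieszConj J φ‖ ^ 2 = (C * ‖e φ‖) ^ 2 := by
      apply Complex.ofReal_injective
      push_cast
      rw [mul_pow]
      exact h2
    exact (pow_left_inj₀ (norm_nonneg _) (by positivity) two_ne_zero).1 h3
  obtain ⟨A, hAe⟩ : ∃ A : Lp ℂ 2 (volume : Measure (EuclideanSpace ℝ (Fin d))) →L[ℂ] H,
      ∀ φ, A (e φ) = TransMod.rieszConj J φ :=
    ⟨_, LinearMap.extendOfNorm_eq he ⟨C, fun φ => (hnorm φ).le⟩⟩
  have hAnorm : ∀ g, ‖A g‖ = C * ‖g‖ := fun g =>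
    he.induction_on (p := fun g => ‖A g‖ = C * ‖g‖) g
      (isClosed_eq (by fun_prop) (by fun_prop)) fun φ => by rw [hAe, hnorm]
  -- By density it suffices to take `g` Schwartz, where the form evaluates to `C ^ 2 * ∫ g χ`.
  have hJA : ∀ g χ, J (A g) χ = (C ^ 2 : ℂ) * Lp.toTemperedDistributionCLM ℂ volume 2 g χ := by
    intro g χ
    refine he.induction_on (p := fun g => J (A g) χ =
      (C ^ 2 : ℂ) * Lp.toTemperedDistributionCLM ℂ volume 2 g χ) g (isClosed_eq ?_ ?_) fun φ => ?_
    · exact (PointwiseConvergenceCLM.evalCLM (RingHom.id ℂ) ℂ χ).continuous.comp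
        (J.continuous.comp A.continuous)
    · exact continuous_const.mul
        ((PointwiseConvergenceCLM.evalCLM (RingHom.id ℂ) ℂ χ).continuous.comp
          (Lp.toTemperedDistributionCLM ℂ volume 2).continuous)
    · rw [hAe, ← TransMod.inner_riesz_left, TransMod.rieszConj_apply, hBC]
      congr 1
      refine (inner_toL2_toL2_eq _ _ volume).trans ?_
      change _ = Lp.toTemperedDistribution (φ.toLp 2 volume) χ
      rw [Lp.toTemperedDistribution_toLp_eq]
      refine Eq.trans ?_ (toTemperedDistributionCLM_apply_apply volume φ χ).symm
      refine integral_congr_ae (Filter.Eventually.of_forall fun x => ?_)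
      simp
  have hsurj : Function.Surjective A := by
    have hanti : AntilipschitzWith (Real.toNNReal C⁻¹) A :=
      AddMonoidHomClass.antilipschitz_of_bound A fun g => by
        rw [hAnorm, Real.coe_toNNReal _ (inv_nonneg.2 hC.le), inv_mul_cancel_left₀ hC.ne']
    have hclosed : IsClosed (Set.range A) := hanti.isClosed_range A.uniformContinuous
    have hcomplete : CompleteSpace A.range := hclosed.completeSpace_coe
    -- The range is closed and contains every `riesz J φ`; a vector orthogonal to all of these has
    -- zero image under `J`.
    suffices h : A.range = ⊤ from LinearMap.range_eq_top.1 h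
    rw [← Submodule.orthogonal_eq_bot_iff, Submodule.eq_bot_iff]
    intro f hf
    refine hJ ?_
    ext φ
    rw [map_zero, ← TransMod.inner_riesz_left]
    have hmem : TransMod.riesz J φ ∈ A.range := by
      refine ⟨e (TransMod.conjSchwartz φ), (hAe _).trans ?_⟩
      rw [TransMod.rieszConj_apply]
      congr 1
      ext x
      simp
    exact (Submodule.mem_orthogonal _ _).1 hf _ hmem
  have hJA' : ∀ g, J (A (((C : ℂ) ^ 2)⁻¹ • g)) = Lp.toTemperedDistributionCLM ℂ volume 2 g := by
    intro g
    ext χ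
    rw [hJA, map_smul]
    exact mul_inv_cancel_left₀ (pow_ne_zero 2 hCc) _
  -- The preimage of `g` under `J` is `C⁻² • A g`, of norm `C⁻² * C * ‖g‖`, hence the constant
  -- `C⁻¹`.
  refine ⟨Set.Subset.antisymm ?_ ?_, C⁻¹, inv_pos.2 hC, fun f g hfg => ?_⟩
  · rintro _ ⟨f, rfl⟩
    obtain ⟨g, rfl⟩ := hsurj f
    refine ⟨((C : ℂ) ^ 2) • g, ?_⟩
    rw [← hJA', inv_smul_smul₀ (pow_ne_zero 2 hCc)]
  · rintro _ ⟨g, rfl⟩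
    exact ⟨_, hJA' g⟩
  · rw [← hJA'] at hfg
    rw [hJ hfg, hAnorm, norm_smul, norm_inv, norm_pow, Complex.norm_of_nonneg hC.le]
    field_simp
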